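/- Let $x\colon[0,1]\to\mathbb{R}$ be a continuous function. For $m\in\mathbb{N}_0$ and $k=0,\dots,2^m-1$, let $$\theta_{m,k} = 2^{m/2}\left(2x\Big(\frac{2k+1}{2^{m+1}}\Big)-x\Big(\frac{k}{2^m}\Big)-x\Big(\frac{k+1}{2^m}\Big)\right)$$ be the Faber--Schauder coefficients of $x$, and for $n\in\mathbb{N}_0$ let $$s_n=\sqrt{\sum_{m=0}^{n-1}\sum_{k=0}^{2^m-1}\theta_{m,k}^2}.$$ Then the following assertions hold. (a) If $\sup_n s_n<\infty$, then $x$ is of bounded variation on $[0,1]$. (b) If $x$ is of bounded variation on $[0,1]$, then $\sup_{n} 2^{-n/2}\sum_{k=0}^{2^n-1}|\theta_{n,k}|<\infty$. -/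

import Mathlib

noncomputable section

/-- The Faber-Schauder coefficient
`θ_{m,k} = 2^{m/2} (2 x((2k+1)/2^{m+1}) - x(k/2^m) - x((k+1)/2^m))` of a function `x` on `[0,1]`;
for `k < 2^m` only values of `x` on `[0,1]` enter. -/
def faberSchauderCoeff (x : ℝ → ℝ) (m k : ℕ) : ℝ :=
  (2 : ℝ) ^ ((m : ℝ) / 2) *
    (2 * x ((2 * (k : ℝ) + 1) / 2 ^ (m + 1)) - x ((k : ℝ) / 2 ^ m) - x (((k : ℝ) + 1) / 2 ^ m))

/-- `s_n = √(∑_{m<n} ∑_{k<2^m} θ_{m,k}²)`. -/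
def faberSchauderS (x : ℝ → ℝ) (n : ℕ) : ℝ :=
  Real.sqrt (∑ m ∈ Finset.range n, ∑ k ∈ Finset.range (2 ^ m), faberSchauderCoeff x m k ^ 2)

end

/-! If `a`, `b` are the increments of `x` over the two halves of a dyadic interval of level `n`,
then `θ_{n,k} = 2^{n/2} (a - b)`, while `a + b` is the increment over the whole. By `2(a² + b²) = (a
+ b)² + (a - b)²`, the scaled energies telescope (`sum_sq_dyadicIncrement`). Cauchy–Schwarz then
bounds the dyadic variations by the `s_n`, and continuity extends the bound to all partitions
(`boundedVariationOn_of_dyadic`). Part (b) is `|a - b| ≤ |a| + |b|`. -/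

/-- Splitting a sum over `range (2 * N)` into consecutive pairs. -/
theorem sum_range_two_mul_pairs (f : ℕ → ℝ) (N : ℕ) :
    ∑ k ∈ Finset.range (2 * N), f k = ∑ k ∈ Finset.range N, (f (2 * k) + f (2 * k + 1)) := by
  induction N with
  | zero => simp
  | succ N ih =>
    rw [show 2 * (N + 1) = 2 * N + 1 + 1 by ring, Finset.sum_range_succ, Finset.sum_range_succ,
      Finset.sum_range_succ, ih]
    ring

/-- The increment of `x` over the `k`-th dyadic interval of level `n`. -/
noncomputable def dyadicIncrement (x : ℝ → ℝ) (n k : ℕ) : ℝ :=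
  x (((k + 1 : ℕ) : ℝ) / 2 ^ n) - x ((k : ℝ) / 2 ^ n)

theorem dyadicIncrement_add (x : ℝ → ℝ) (n k : ℕ) :
    dyadicIncrement x (n + 1) (2 * k) + dyadicIncrement x (n + 1) (2 * k + 1) =
      dyadicIncrement x n k := by
  unfold dyadicIncrement
  have h0 : ((2 * k : ℕ) : ℝ) / 2 ^ (n + 1) = (k : ℝ) / 2 ^ n := by
    push_cast; field_simp; ring
  have h1 : ((2 * k + 1 + 1 : ℕ) : ℝ) / 2 ^ (n + 1) = ((k + 1 : ℕ) : ℝ) / 2 ^ n := by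
    push_cast; field_simp; ring
  rw [h0, h1]
  ring

theorem faberSchauderCoeff_eq (x : ℝ → ℝ) (n k : ℕ) :
    faberSchauderCoeff x n k = (2 : ℝ) ^ ((n : ℝ) / 2) *
      (dyadicIncrement x (n + 1) (2 * k) - dyadicIncrement x (n + 1) (2 * k + 1)) := by
  unfold dyadicIncrement faberSchauderCoeff
  have h0 : ((2 * k : ℕ) : ℝ) / 2 ^ (n + 1) = (k : ℝ) / 2 ^ n := by
    push_cast; field_simp; ring
  have h1 : ((2 * k + 1 + 1 : ℕ) : ℝ) / 2 ^ (n + 1) = ((k : ℝ) + 1) / 2 ^ n := by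
    push_cast; field_simp; ring
  rw [h0, h1]
  push_cast
  ring

theorem faberSchauderCoeff_sq (x : ℝ → ℝ) (n k : ℕ) :
    faberSchauderCoeff x n k ^ 2 = (2 : ℝ) ^ n *
      (dyadicIncrement x (n + 1) (2 * k) - dyadicIncrement x (n + 1) (2 * k + 1)) ^ 2 := by
  rw [faberSchauderCoeff_eq, mul_pow, ← Real.rpow_mul_natCast (by norm_num)]
  have h : (n : ℝ) / 2 * (2 : ℕ) = n := by push_cast; ring
  rw [h, Real.rpow_natCast]

/-- The discrete Dirichlet energies of the dyadic interpolations of `x` are, up to a constant, the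
partial sums of the squared Faber-Schauder coefficients. -/
theorem sum_sq_dyadicIncrement (x : ℝ → ℝ) (n : ℕ) :
    (2 : ℝ) ^ n * ∑ k ∈ Finset.range (2 ^ n), dyadicIncrement x n k ^ 2 =
      (x 1 - x 0) ^ 2 +
        ∑ m ∈ Finset.range n, ∑ k ∈ Finset.range (2 ^ m), faberSchauderCoeff x m k ^ 2 := by
  induction n with
  | zero => simp [dyadicIncrement]
  | succ n ih =>
    rw [Finset.sum_range_succ, ← add_assoc, ← ih, pow_succ' (2 : ℝ) n, pow_succ' (2 : ℕ) n,
      sum_range_two_mul_pairs, Finset.mul_sum, Finset.mul_sum, ← Finset.sum_add_distrib]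
    refine Finset.sum_congr rfl fun k _ => ?_
    rw [faberSchauderCoeff_sq, ← dyadicIncrement_add x n k]
    ring

theorem sum_abs_dyadicIncrement_sq_le (x : ℝ → ℝ) (n : ℕ) :
    (∑ k ∈ Finset.range (2 ^ n), |dyadicIncrement x n k|) ^ 2 ≤
      (x 1 - x 0) ^ 2 + faberSchauderS x n ^ 2 := by
  have h := sq_sum_le_card_mul_sum_sq (s := Finset.range (2 ^ n))
    (f := fun k => |dyadicIncrement x n k|)
  rw [faberSchauderS, Real.sq_sqrt (by positivity), ← sum_sq_dyadicIncrement]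
  simpa [sq_abs] using h

/-- The variation of a sequence along a monotone reindexing is at most its full variation. -/
theorem sum_abs_sub_comp_le (f : ℕ → ℝ) {v : ℕ → ℕ} (hv : Monotone v) {M : ℕ}
    (hM : ∀ i, v i ≤ M) (N : ℕ) :
    ∑ i ∈ Finset.range N, |f (v (i + 1)) - f (v i)| ≤
      ∑ k ∈ Finset.range M, |f (k + 1) - f k| := by
  set g : ℕ → ℝ := fun j => ∑ k ∈ Finset.range j, |f (k + 1) - f k|
  have key (a b : ℕ) (hab : a ≤ b) : |f b - f a| ≤ g b - g a := by
    rw [← Finset.sum_Ico_eq_sub _ hab, ← Finset.sum_Ico_sub f hab]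
    exact Finset.abs_sum_le_sum_abs _ _
  have hg : g (v N) ≤ g M :=
    Finset.sum_le_sum_of_subset_of_nonneg (Finset.range_mono (hM N)) fun _ _ _ => abs_nonneg _
  have h0 : 0 ≤ g (v 0) := Finset.sum_nonneg fun _ _ => abs_nonneg _
  calc ∑ i ∈ Finset.range N, |f (v (i + 1)) - f (v i)|
      ≤ ∑ i ∈ Finset.range N, (g (v (i + 1)) - g (v i)) :=
        Finset.sum_le_sum fun i _ => key _ _ (hv i.le_succ)
    _ = g (v N) - g (v 0) := Finset.sum_range_sub (fun i => g (v i)) N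
    _ ≤ g M := by linarith

theorem tendsto_floor_mul_two_pow_div {t : ℝ} (ht : 0 ≤ t) :
    Filter.Tendsto (fun n : ℕ => ((⌊t * 2 ^ n⌋₊ : ℕ) : ℝ) / 2 ^ n) Filter.atTop (nhds t) :=
  (tendsto_nat_floor_mul_div_atTop ht).comp (tendsto_pow_atTop_atTop_of_one_lt one_lt_two)

/-- A continuous function on `[0,1]` whose variations along the dyadic partitions are bounded is of
bounded variation. -/
theorem boundedVariationOn_of_dyadic {x : ℝ → ℝ} (hx : ContinuousOn x (Set.Icc (0 : ℝ) 1)) {C : ℝ}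
    (hC : ∀ n, ∑ k ∈ Finset.range (2 ^ n), |dyadicIncrement x n k| ≤ C) :
    BoundedVariationOn x (Set.Icc (0 : ℝ) 1) := by
  have hle : eVariationOn x (Set.Icc (0 : ℝ) 1) ≤ ENNReal.ofReal C := by
    refine iSup_le ?_
    rintro ⟨N, u, hu, hmem⟩
    -- Each partition point is rounded down to the grid of level `n`. Rounding preserves order, so
    -- the rounded sums are at most `C`; then `n → ∞`.
    have hfloor (i n : ℕ) : ⌊u i * 2 ^ n⌋₊ ≤ 2 ^ n := by
      refine Nat.floor_le_of_le ?_
      push_cast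
      exact mul_le_of_le_one_left (by positivity) (hmem i).2
    have hlim (i : ℕ) : Filter.Tendsto (fun n : ℕ => x (((⌊u i * 2 ^ n⌋₊ : ℕ) : ℝ) / 2 ^ n))
        Filter.atTop (nhds (x (u i))) := by
      refine (hx (u i) (hmem i)).tendsto.comp (tendsto_nhdsWithin_iff.2
        ⟨tendsto_floor_mul_two_pow_div (hmem i).1, Filter.Eventually.of_forall fun n => ?_⟩)
      refine ⟨by positivity, div_le_one_of_le₀ ?_ (by positivity)⟩
      exact_mod_cast hfloor i n
    have hsum : ∑ i ∈ Finset.range N, |x (u (i + 1)) - x (u i)| ≤ C := by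
      refine le_of_tendsto (tendsto_finsetSum _ fun i _ => ((hlim (i + 1)).sub (hlim i)).abs)
        (Filter.Eventually.of_forall fun n => ?_)
      refine (sum_abs_sub_comp_le (fun k : ℕ => x ((k : ℝ) / 2 ^ n))
        (v := fun i => ⌊u i * 2 ^ n⌋₊) (fun i j hij => ?_) (fun i => hfloor i n) N).trans (hC n)
      exact Nat.floor_mono (mul_le_mul_of_nonneg_right (hu hij) (by positivity))
    calc ∑ i ∈ Finset.range N, edist (x (u (i + 1))) (x (u i))
        = ENNReal.ofReal (∑ i ∈ Finset.range N, |x (u (i + 1)) - x (u i)|) := by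
          rw [ENNReal.ofReal_sum_of_nonneg fun _ _ => abs_nonneg _]
          simp only [edist_dist, Real.dist_eq]
      _ ≤ ENNReal.ofReal C := ENNReal.ofReal_le_ofReal hsum
  exact ne_top_of_le_ne_top ENNReal.ofReal_ne_top hle

theorem sum_abs_dyadicIncrement_le {x : ℝ → ℝ} (hx : BoundedVariationOn x (Set.Icc (0 : ℝ) 1))
    (n : ℕ) :
    ∑ k ∈ Finset.range (2 ^ n), |dyadicIncrement x n k| ≤
      (eVariationOn x (Set.Icc (0 : ℝ) 1)).toReal := by
  -- Only indices up to `2 ^ n` are constrained: beyond them `k / 2 ^ n` leaves `[0,1]`.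
  have h := eVariationOn.sum_le_of_monotoneOn_Iic (f := x) (s := Set.Icc (0 : ℝ) 1) (n := 2 ^ n)
    (u := fun k : ℕ => (k : ℝ) / 2 ^ n)
    (fun i _ j _ hij => div_le_div_of_nonneg_right (Nat.cast_le.2 hij) (by positivity))
    (fun i hi => ⟨by positivity, div_le_one_of_le₀ (by exact_mod_cast hi) (by positivity)⟩)
  refine (ENNReal.ofReal_le_iff_le_toReal hx).1 ?_
  rw [ENNReal.ofReal_sum_of_nonneg fun _ _ => abs_nonneg _]
  simpa only [edist_dist, Real.dist_eq, dyadicIncrement] using h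

theorem rpow_mul_sum_abs_faberSchauderCoeff_le (x : ℝ → ℝ) (n : ℕ) :
    (2 : ℝ) ^ (-(n : ℝ) / 2) * ∑ k ∈ Finset.range (2 ^ n), |faberSchauderCoeff x n k| ≤
      ∑ k ∈ Finset.range (2 ^ (n + 1)), |dyadicIncrement x (n + 1) k| := by
  rw [pow_succ' 2 n, sum_range_two_mul_pairs, Finset.mul_sum]
  refine Finset.sum_le_sum fun k _ => ?_
  have h2 : (2 : ℝ) ^ (-(n : ℝ) / 2) * (2 : ℝ) ^ ((n : ℝ) / 2) = 1 := by
    rw [← Real.rpow_add two_pos, neg_div, neg_add_cancel, Real.rpow_zero]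
  rw [faberSchauderCoeff_eq, abs_mul, abs_of_pos (Real.rpow_pos_of_pos two_pos _), ← mul_assoc, h2,
    one_mul]
  exact abs_sub _ _

theorem mainTheorem8 (x : ℝ → ℝ) (hx : ContinuousOn x (Set.Icc (0 : ℝ) 1)) :
    (BddAbove (Set.range fun n : ℕ => faberSchauderS x n) →
      BoundedVariationOn x (Set.Icc (0 : ℝ) 1)) ∧
    (BoundedVariationOn x (Set.Icc (0 : ℝ) 1) →
      BddAbove (Set.range fun n : ℕ =>
        (2 : ℝ) ^ (-(n : ℝ) / 2) *
          ∑ k ∈ Finset.range (2 ^ n), |faberSchauderCoeff x n k|)) := by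
  constructor
  · rintro ⟨B, hB⟩
    refine boundedVariationOn_of_dyadic hx (C := Real.sqrt ((x 1 - x 0) ^ 2 + B ^ 2)) fun n => ?_
    refine Real.le_sqrt_of_sq_le ((sum_abs_dyadicIncrement_sq_le x n).trans ?_)
    have hn : faberSchauderS x n ≤ B := hB ⟨n, rfl⟩
    have h0 : 0 ≤ faberSchauderS x n := Real.sqrt_nonneg _
    gcongr
  · intro hbv
    refine ⟨(eVariationOn x (Set.Icc (0 : ℝ) 1)).toReal, ?_⟩
    rintro _ ⟨n, rfl⟩
    exact (rpow_mul_sum_abs_faberSchauderCoeff_le x n).trans (sum_abs_dyadicIncrement_le hbv _)
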